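/- Let $\Bbbk$ be an algebraically closed field of characteristic zero, and for $n,d\ge 0$ let $R_d$ be the $\binom{n+d}{d}$-dimensional space of forms of degree $d$ in $\Bbbk[x_0,\dots,x_n]$. Let $\mathrm{Split}_d(\mathbb P^n)\subset\mathbb P(R_d)=\mathbb P^{\binom{n+d}{d}-1}$ be the variety of completely decomposable forms, i.e. of all $[f]$ with $f=\ell_1\cdots\ell_d\neq 0$ a product of $d$ linear forms. For a projective variety $X\subset\mathbb P^N$ let the $s$-th secant variety $\sigma_s(X)$ be the Zariski closure of the union of the linear spans $\langle p_1,\dots,p_s\rangle$ of $s$ points of $X$; it is called nondefective if its dimension is not less than the expected dimension $\min\{s(\dim X+1)-1,\,N\}$. Let $d,s,n_0$ be natural numbers such that $s(dn_0+1)\le\binom{n_0+d}{d}$ and $\sigma_s(\mathrm{Split}_d(\mathbb P^{n_0}))$ is nondefective. Then $\sigma_s(\mathrm{Split}_d(\mathbb P^n))$ is nondefective for all $n\ge n_0$. -/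

import Mathlib

open scoped LinearAlgebra.Projectivization

namespace SplitSecant

section ProjectiveSets

variable {k : Type*} [Field k] {ι : Type*}

/-- The Zariski closure of a subset `X` of the projective space of lines in `ι → k`: the common
zeros of all homogeneous polynomials vanishing on `X`. The vanishing of a homogeneous polynomial at
a point does not depend on the chosen representative. -/
def zariskiClosure (X : Set (ℙ k (ι → k))) : Set (ℙ k (ι → k)) :=
  {p | ∀ (m : ℕ) (F : MvPolynomial ι k), F.IsHomogeneous m →
    (∀ q ∈ X, MvPolynomial.eval q.rep F = 0) → MvPolynomial.eval p.rep F = 0}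

/-- The affine cone over `X`: the preimage of `X` in the affine space `ι → k`, together with `0`. -/
def affineCone (X : Set (ℙ k (ι → k))) : Set (ι → k) :=
  {v | ∀ hv : v ≠ 0, Projectivization.mk k v hv ∈ X}

/-- The (homogeneous) coordinate ring of `X`, i.e. the coordinate ring of its affine cone. -/
abbrev CoordinateRing (X : Set (ℙ k (ι → k))) : Type _ :=
  MvPolynomial ι k ⧸ MvPolynomial.vanishingIdeal k (affineCone X)

/-- The dimension of `X`: one less than the dimension of its affine cone, the latter being the Krull
dimension of the coordinate ring. For finite `ι` this Krull dimension is a natural number (the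
cone contains `0`, so the ring is nonzero), and the dimension of the empty set is `-1`. -/
noncomputable def dim (X : Set (ℙ k (ι → k))) : ℤ :=
  (((ringKrullDim (CoordinateRing X)).unbotD 0).toNat : ℤ) - 1

/-- The union of the linear spans of all `s`-tuples of points of `X`. -/
def spanUnion (s : ℕ) (X : Set (ℙ k (ι → k))) : Set (ℙ k (ι → k)) :=
  {q | ∃ p : Fin s → ℙ k (ι → k), (∀ i, p i ∈ X) ∧ q.submodule ≤ ⨆ i, (p i).submodule}

/-- The `s`-th secant variety `σ_s(X)`. -/
def secantVariety (s : ℕ) (X : Set (ℙ k (ι → k))) : Set (ℙ k (ι → k)) :=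
  zariskiClosure (spanUnion s X)

/-- The expected dimension `min {s (dim X + 1) - 1, N}` of the `s`-th secant variety of
`X ⊆ ℙ^N`, where `N + 1` is the number of homogeneous coordinates. -/
noncomputable def expDim [Fintype ι] (s : ℕ) (X : Set (ℙ k (ι → k))) : ℤ :=
  min ((s : ℤ) * (dim X + 1) - 1) ((Fintype.card ι : ℤ) - 1)

/-- The `s`-th secant variety of `X` is defective if its dimension is less than expected. -/
def SecantDefective [Fintype ι] (s : ℕ) (X : Set (ℙ k (ι → k))) : Prop :=
  dim (secantVariety s X) < expDim s X

/-- The `s`-th secant variety of `X` is nondefective if it is not defective. -/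
def SecantNondefective [Fintype ι] (s : ℕ) (X : Set (ℙ k (ι → k))) : Prop :=
  ¬ SecantDefective s X

end ProjectiveSets

/-- The exponents of the monomials of degree `d` in `x_0, …, x_n`. -/
abbrev Exponent (n d : ℕ) : Type :=
  ↥(Finset.finsuppAntidiag (Finset.univ : Finset (Fin (n + 1))) d)

variable {k : Type*} [Field k]

/-- The coefficient vector of the degree `d` part of a polynomial in `x_0, …, x_n`; on forms of
degree `d` this is the identification of `R_d` with a coordinate space. -/
def coeffVector (n d : ℕ) (f : MvPolynomial (Fin (n + 1)) k) : Exponent n d → k :=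
  fun m => f.coeff m.1

/-- A completely decomposable form of degree `d`: a product of `d` linear forms. -/
def IsCompletelyDecomposable (n d : ℕ) (f : MvPolynomial (Fin (n + 1)) k) : Prop :=
  ∃ l : Fin d → MvPolynomial (Fin (n + 1)) k, (∀ i, (l i).IsHomogeneous 1) ∧ f = ∏ i, l i

variable (k) in
/-- The variety `Split_d(ℙ^n)` of completely decomposable forms of degree `d` in `n + 1`
variables, inside the projective space of all forms of degree `d`. -/
def split (d n : ℕ) : Set (ℙ k (Exponent n d → k)) :=
  {p | ∃ (f : MvPolynomial (Fin (n + 1)) k) (hf : coeffVector n d f ≠ 0),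
    IsCompletelyDecomposable n d f ∧ p = Projectivization.mk k (coeffVector n d f) hf}

end SplitSecant

open MvPolynomial

/-! ### Krull dimension and transcendence degree -/

section KrullDimension

/-! The cone over the secant variety is the closure of the image of a polynomial map: coefficients
of `s * d` linear forms go to the coefficients of the sum of `s` products. Its coordinate ring is
the algebra generated by the components of this map, so in characteristic zero its dimension is the
maximal rank of the Jacobian (Terracini). At `p` this rank is `s * d * (n + 1)` minus the dimension
of the kernel of `tangentMap p` (`dim_secantVariety_split_bounds`).

If all factors are nonzero, the kernel contains the rescalings of factors by scalars summing to zero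
within each product, a space of dimension `s * (d - 1)`. For `s ≥ 2` the numerical hypothesis turns
nondefectivity at `n₀` into: for some `p` there is nothing else in the kernel.

This property passes from `n` to `n + 1` with the same forms (`finrank_ker_tangentMap_snoc_le`). The
new coordinates of a kernel vector give a linear relation among the products with one factor
omitted. Multiplying such a relation by any linear form yields a kernel vector in the old variables,
hence a rescaling; so a nonzero coefficient would make every linear form a multiple of one factor,
which is absurd in at least two variables. -/

theorem ringKrullDim_eq_of_isIntegral (R S : Type*) [CommRing R] [CommRing S] [Algebra R S]
    [Algebra.IsIntegral R S] [FaithfulSMul R S] : ringKrullDim R = ringKrullDim S := by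
  apply le_antisymm
  · refine iSup_le fun l => ?_
    obtain ⟨⟨Q, hQ, hlo⟩⟩ := Ideal.nonempty_primesOver (S := S) l.head.asIdeal
    obtain ⟨L, hL, -⟩ := Ideal.exists_ltSeries_of_hasGoingUp (S := S) l Q
    rw [← hL]
    exact Order.LTSeries.length_le_krullDim L
  · exact Order.krullDim_le_of_strictMono (PrimeSpectrum.comap (algebraMap R S))
      fun _ _ h => Ideal.IsIntegral.comap_lt_comap h

/-- Noether normalization: `A` is integral over a polynomial ring in `e` variables, and both
invariants are unchanged by integral extension. -/
theorem exists_ringKrullDim_eq_trdeg (k A : Type*) [Field k] [CommRing A] [IsDomain A]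
    [Algebra k A] [Algebra.FiniteType k A] :
    ∃ e : ℕ, ringKrullDim A = e ∧ Algebra.trdeg k A = e := by
  obtain ⟨e, g, hinj, hint⟩ := exists_integral_inj_algHom_of_fg k A
  algebraize [g.toRingHom]
  have : Algebra.IsIntegral (MvPolynomial (Fin e) k) A := ⟨hint⟩
  have : FaithfulSMul (MvPolynomial (Fin e) k) A :=
    (faithfulSMul_iff_algebraMap_injective _ _).2 hinj
  have : IsScalarTower k (MvPolynomial (Fin e) k) A := .of_algebraMap_eq fun x => by
    rw [RingHom.algebraMap_toAlgebra]; exact (g.commutes x).symm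
  refine ⟨e, ?_, ?_⟩
  · rw [← ringKrullDim_eq_of_isIntegral (MvPolynomial (Fin e) k) A]
    simp
  · have h := (IsTranscendenceBasis.mvPolynomial (Fin e) k).algebraMap_comp (A := A)
    have := h.lift_cardinalMk_eq_trdeg
    simpa using! this.symm

end KrullDimension

/-! ### Derivations and algebraic elements -/

section Derivations

theorem Derivation.map_aeval_of_subalgebra {k A M : Type*} [CommRing k] [CommRing A] [Algebra k A]
    [AddCommGroup M] [Module A M] [Module k M] (D : Derivation k A M) (S : Subalgebra k A)
    (hS : ∀ y ∈ S, D y = 0) (x : A) (f : Polynomial S) :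
    D (Polynomial.aeval x f) = Polynomial.aeval x (Polynomial.derivative f) • D x := by
  induction f using Polynomial.induction_on' with
  | add p q hp hq => simp [hp, hq, add_smul]
  | monomial n a =>
    rw [Polynomial.aeval_monomial, D.leibniz, D.leibniz_pow, Polynomial.derivative_monomial,
      Polynomial.aeval_monomial]
    have : D (algebraMap S A a) = 0 := hS _ a.2
    rw [this, smul_zero, add_zero, map_mul, mul_assoc, mul_smul, mul_smul,
      show algebraMap S A (n : S) = n from _root_.map_natCast _ n, Nat.cast_smul_eq_nsmul]

/-- Applying `D` to `f(x) = 0` gives `f'(x) • D x = 0`. Either `D x = 0`, or `f'` is a nonzero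
relation of smaller degree and descent applies. -/
theorem Derivation.eq_zero_of_isAlgebraic {k A M : Type*} [Field k] [CharZero k] [CommRing A]
    [IsDomain A] [Algebra k A] [AddCommGroup M] [Module A M] [Module k M]
    [Module.IsTorsionFree A M] (D : Derivation k A M) (S : Subalgebra k A)
    (hS : ∀ y ∈ S, D y = 0) {x : A} (hx : IsAlgebraic S x) : D x = 0 := by
  have : CharZero A := charZero_of_injective_algebraMap (algebraMap k A).injective
  have : CharZero S := charZero_of_injective_algebraMap (algebraMap k S).injective
  obtain ⟨f, hf, hfx⟩ := hx
  induction hn : f.natDegree using Nat.strong_induction_on generalizing f with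
  | _ n ih =>
    have h := D.map_aeval_of_subalgebra S hS x f
    rw [hfx, map_zero] at h
    rcases smul_eq_zero.1 h.symm with h | h
    · by_cases h0 : f.natDegree = 0
      · rw [Polynomial.eq_C_of_natDegree_eq_zero h0] at hf hfx
        rw [Polynomial.aeval_C] at hfx
        exact absurd (by simpa using hfx) hf
      · exact ih _ (hn ▸ Polynomial.natDegree_derivative_lt h0) _
          (fun h' => h0 (Polynomial.derivative_eq_zero.1 h')) h rfl
    · exact h

end Derivations

/-! ### Jacobian criterion: generic rank equals transcendence degree -/

section Jacobian

variable {k σ τ : Type*}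

namespace MvPolynomial

/-- The Jacobian matrix of a family of polynomials. -/
noncomputable def jacobianMatrix [CommSemiring k] (φ : τ → MvPolynomial σ k) :
    Matrix τ σ (MvPolynomial σ k) :=
  Matrix.of fun t i => pderiv i (φ t)

theorem pderiv_aeval_eq_sum [CommSemiring k] [Fintype τ] (ψ : τ → MvPolynomial σ k) (i : σ)
    (F : MvPolynomial τ k) :
    pderiv i (aeval ψ F) = ∑ t, aeval ψ (pderiv t F) * pderiv i (ψ t) := by
  classical
  induction F using MvPolynomial.induction_on with
  | C a => simp [algebraMap_eq]
  | add p q hp hq => simp only [map_add, hp, hq, add_mul, Finset.sum_add_distrib]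
  | mul_X p t hp =>
    simp only [map_mul, aeval_X, pderiv_mul, hp, map_add, add_mul, Finset.sum_add_distrib,
      pderiv_X, Finset.sum_mul]
    congr 1
    · exact Finset.sum_congr rfl fun _ _ => by ring
    · rw [Finset.sum_eq_single t]
      · simp
      · intro b _ hb; simp [hb.symm]
      · simp

theorem totalDegree_pderiv_le [CommSemiring k] (F : MvPolynomial τ k) (t : τ) {N : ℕ}
    (h : F.totalDegree ≤ N + 1) : (pderiv t F).totalDegree ≤ N := by
  refine Finset.sup_le fun m hm => ?_
  have : m + Finsupp.single t 1 ∈ F.support := by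
    rw [mem_support_iff, coeff_pderiv] at hm
    exact mem_support_iff.2 fun h0 => hm (by rw [h0, zero_mul])
  have := (le_totalDegree this).trans h
  change (m + Finsupp.single t 1).degree ≤ N + 1 at this
  change m.degree ≤ N
  simpa using this

theorem eq_C_of_pderiv_eq_zero [Field k] [CharZero k] (F : MvPolynomial τ k)
    (h : ∀ t, pderiv t F = 0) : F = C (coeff 0 F) := by
  classical
  ext m
  rw [coeff_C]
  split_ifs with h0
  · rw [h0]
  · obtain ⟨t, ht⟩ := Finsupp.ne_iff.1 (Ne.symm h0)
    have h1 : Finsupp.single t 1 ≤ m := by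
      rw [Finsupp.single_le_iff]; exact Nat.one_le_iff_ne_zero.2 ht
    have h2 := coeff_pderiv (i := t) F (m - Finsupp.single t 1)
    rw [h, coeff_zero, tsub_add_cancel_of_le h1] at h2
    exact (mul_eq_zero.1 h2.symm).resolve_right (Nat.cast_add_one_ne_zero _)

/-- The factor `B` certifies full row rank. By the chain rule, the gradient of a relation, evaluated
at `ψ`, is killed by the Jacobian, so all partial derivatives are again relations; induct on degree.
-/
theorem algebraicIndependent_of_jacobian_mul_det_ne_zero [Field k] [CharZero k] [Fintype σ] [Fintype τ]
    [DecidableEq τ] (ψ : τ → MvPolynomial σ k) (B : Matrix σ τ (MvPolynomial σ k))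
    (hB : (jacobianMatrix ψ * B).det ≠ 0) : AlgebraicIndependent k ψ := by
  rw [algebraicIndependent_iff]
  suffices H : ∀ (N : ℕ) (F : MvPolynomial τ k), F.totalDegree ≤ N → aeval ψ F = 0 → F = 0 from
    fun F hF => H _ F le_rfl hF
  have key : ∀ F : MvPolynomial τ k, aeval ψ F = 0 → ∀ t, aeval ψ (pderiv t F) = 0 := by
    intro F hF
    suffices (fun t => aeval ψ (pderiv t F)) = 0 from fun t => congrFun this t
    apply Matrix.eq_zero_of_vecMul_eq_zero hB
    rw [← Matrix.vecMul_vecMul]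
    suffices Matrix.vecMul (fun t => aeval ψ (pderiv t F)) (jacobianMatrix ψ) = 0 by
      rw [this, Matrix.zero_vecMul]
    refine _root_.funext fun i => ?_
    have := pderiv_aeval_eq_sum ψ i F
    rw [hF, map_zero] at this
    simpa only [Matrix.vecMul, dotProduct, jacobianMatrix, Matrix.of_apply] using! this.symm
  have fin : ∀ F : MvPolynomial τ k, aeval ψ F = 0 → (∀ t, pderiv t F = 0) → F = 0 := by
    intro F hF h
    rw [eq_C_of_pderiv_eq_zero F h] at hF ⊢
    simpa using hF
  intro N
  induction N with
  | zero =>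
    intro F hN hF
    refine fin F hF fun t => ?_
    rw [totalDegree_eq_zero_iff_eq_C.1 (Nat.le_zero.1 hN), pderiv_C]
  | succ N ih =>
    intro F hN hF
    exact fin F hF fun t => ih _ (totalDegree_pderiv_le F t hN) (key F hF t)

theorem rank_jacobianMatrix_le_trdeg [Field k] [CharZero k] [Fintype σ] [Fintype τ]
    (φ : τ → MvPolynomial σ k) (p : σ → k) {e : ℕ}
    (he : Algebra.trdeg k (aeval (R := k) φ).range = e) :
    ((jacobianMatrix φ).map (eval p)).rank ≤ e := by
  classical
  set M := (jacobianMatrix φ).map (eval p) with hM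
  obtain ⟨f, hf, -, hli⟩ := Submodule.exists_fun_fin_finrank_span_eq k (Set.range M.row)
  choose t ht using hf
  have hr := Matrix.rank_eq_finrank_span_row M
  have hrows : LinearIndependent k (M.submatrix t id).row := by
    rwa [show (M.submatrix t id).row = f from _root_.funext ht]
  have hsurj : Function.Surjective (M.submatrix t id).mulVec := by
    have h1 := hrows.rank_matrix
    rw [← Matrix.coe_mulVecLin, ← LinearMap.range_eq_top]
    apply Submodule.eq_top_of_finrank_eq
    rw [Module.finrank_fintype_fun_eq_card]
    exact h1
  obtain ⟨B, hB⟩ := Matrix.mulVec_surjective_iff_exists_right_inverse.1 hsurj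
  -- The right inverse at `p`, taken as constant polynomials: the determinant below takes the value
  -- 1 at `p`.
  let B' : Matrix σ (Fin _) (MvPolynomial σ k) := B.map C
  have hdet : (jacobianMatrix (φ ∘ t) * B').det ≠ 0 := by
    intro h0
    have h1 := RingHom.map_det (eval p) (jacobianMatrix (φ ∘ t) * B')
    rw [h0, map_zero, RingHom.mapMatrix_apply, Matrix.map_mul] at h1
    have h2 : (jacobianMatrix (φ ∘ t)).map (eval p) = M.submatrix t id := rfl
    have h3 : B'.map (eval p) = B := by ext; simp [B']
    rw [h2, h3, hB, Matrix.det_one] at h1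
    exact zero_ne_one h1
  have hind := algebraicIndependent_of_jacobian_mul_det_ne_zero _ _ hdet
  have hind' : AlgebraicIndependent k
      (fun i => (⟨φ (t i), X (t i), by simp⟩ : (aeval (R := k) φ).range)) :=
    AlgebraicIndependent.of_comp (aeval (R := k) φ).range.val hind
  have := hind'.lift_cardinalMk_le_trdeg
  rw [he] at this
  rw [hr]
  rw [Cardinal.mk_fin, Cardinal.lift_natCast, Cardinal.lift_natCast] at this
  exact_mod_cast this

/-- Full row rank over the fraction field, for a transcendence basis chosen among the `φ t`,
survives at a general point. The factor `h` allows an extra open condition on that point. -/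
theorem exists_trdeg_le_rank_jacobianMatrix [Field k] [CharZero k] [Fintype σ] [Fintype τ]
    (φ : τ → MvPolynomial σ k) {e : ℕ} (he : Algebra.trdeg k (aeval (R := k) φ).range = e)
    (h : MvPolynomial σ k) (hh : h ≠ 0) :
    ∃ p : σ → k, eval p h ≠ 0 ∧ e ≤ ((jacobianMatrix φ).map (eval p)).rank := by
  classical
  let A := (aeval (R := k) φ).range
  let φ' : τ → A := fun t => ⟨φ t, X t, by simp⟩
  have hadj : Algebra.adjoin k (Set.range φ') = ⊤ := by
    have : (aeval φ' : MvPolynomial τ k →ₐ[k] A).range = ⊤ := by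
      rw [AlgHom.range_eq_top]
      rintro ⟨_, F, rfl⟩
      refine ⟨F, Subtype.ext ?_⟩
      change A.val (aeval φ' F) = aeval φ F
      rw [comp_aeval_apply]
      rfl
    rw [Algebra.adjoin_range_eq_range_aeval, this]
  have halg : Algebra.IsAlgebraic (Algebra.adjoin k (Set.range φ')) A := by
    rw [hadj]
    exact ⟨fun a => isAlgebraic_algebraMap (⟨a, trivial⟩ : (⊤ : Subalgebra k A))⟩
  obtain ⟨u, hu, hub⟩ := exists_isTranscendenceBasis_subset (R := k) (Set.range φ')
  have hufin : u.Finite := (Set.finite_range φ').subset hu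
  have := hufin.fintype
  have hucard : Fintype.card u = e := by
    have := hub.cardinalMk_eq_trdeg
    rw [he] at this
    simpa using this
  choose t ht using fun y : u => hu y.2
  let K := FractionRing (MvPolynomial σ k)
  let J : Matrix u σ (MvPolynomial σ k) := (jacobianMatrix φ).submatrix t id
  have hsurj : Function.Surjective (J.map (algebraMap _ K)).mulVec := by
    have hT : AlgebraicIndepOn k id (A.val '' u) :=
      (hub.1.map' (f := A.val) Subtype.val_injective).image_of_comp u A.val id
    obtain ⟨w, hTw, hw⟩ := exists_isTranscendenceBasis_superset hT
    have hwcard := (IsTranscendenceBasis.mvPolynomial σ k).lift_cardinalMk_eq hw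
    have hwfin : Finite w := by
      rw [← Cardinal.lt_aleph0_iff_finite, ← Cardinal.lift_lt_aleph0, ← hwcard]
      simp
    have := Fintype.ofFinite w
    rw [Cardinal.mk_fintype, Cardinal.mk_fintype, Cardinal.lift_natCast, Cardinal.lift_natCast,
      Nat.cast_inj] at hwcard
    let Mw : Matrix w σ K := Matrix.of fun y i => algebraMap _ K (pderiv i y.1)
    have hinj : Function.Injective Mw.mulVecLin := by
      rw [← LinearMap.ker_eq_bot, LinearMap.ker_eq_bot']
      intro v hv
      -- Derivative in the direction `v`. It kills the transcendence basis `w`, hence everything,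
      -- and `D (X j)` is `v j`; so the square Jacobian of `w` is invertible.
      let D : Derivation k (MvPolynomial σ k) K :=
        ∑ i, (LinearMap.toSpanSingleton (MvPolynomial σ k) K (v i)).compDer (pderiv i)
      have hD : ∀ y, D y = ∑ i, algebraMap _ K (pderiv i y) * v i := fun y => by
        rw [← Derivation.coeFnAddMonoidHom_apply, map_sum, Finset.sum_apply]
        exact Finset.sum_congr rfl fun i _ => Algebra.smul_def (pderiv i y) (v i)
      have hS : ∀ y ∈ Algebra.adjoin k w, D y = 0 := by
        apply Derivation.eqOn_adjoin (D2 := 0)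
        intro y hy
        rw [hD]
        exact congrFun hv ⟨y, hy⟩
      have halg := hw.isAlgebraic
      rw [Subtype.range_coe] at halg
      refine _root_.funext fun j => ?_
      have := D.eq_zero_of_isAlgebraic _ hS (halg.isAlgebraic (X j))
      rw [hD, Finset.sum_eq_single j] at this
      · simpa using this
      · intro b _ hb; simp [hb.symm]
      · simp
    have hsur : Function.Surjective Mw.mulVecLin :=
      (LinearMap.injective_iff_surjective_of_finrank_eq_finrank
        (by simp [Module.finrank_fintype_fun_eq_card, hwcard])).1 hinj
    let ι : u → w := fun y => ⟨y.1.1, hTw ⟨y.1, y.2, rfl⟩⟩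
    have hι : Function.Injective ι := fun a b hab =>
      Subtype.ext (Subtype.ext (congrArg (fun z : w => z.1) hab))
    intro c
    obtain ⟨c', rfl⟩ := hι.surjective_comp_right c
    obtain ⟨v, rfl⟩ := hsur c'
    refine ⟨v, _root_.funext fun y => ?_⟩
    have : (y : A).1 = φ (t y) := by rw [← ht y]
    simp [Matrix.mulVec, dotProduct, J, Mw, ι, jacobianMatrix, this]
  obtain ⟨B, hB⟩ := Matrix.mulVec_surjective_iff_exists_right_inverse.1 hsurj
  -- Clear denominators in the right inverse: away from the zeros of `b` the rank persists.
  obtain ⟨b, hb⟩ := IsLocalization.exist_integer_multiples_of_finite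
    (nonZeroDivisors (MvPolynomial σ k)) (fun x : σ × u => B x.1 x.2)
  choose B' hB' using hb
  have hJB : J * Matrix.of (fun i j => B' (i, j)) = Matrix.diagonal fun _ => (b : MvPolynomial σ k) := by
    apply Matrix.map_injective (IsFractionRing.injective (MvPolynomial σ k) K)
    beta_reduce
    have : (Matrix.of (fun i j => B' (i, j))).map (algebraMap _ K) =
        (b : MvPolynomial σ k) • B := by
      ext i j; simp [hB']
    rw [Matrix.map_mul, this, Matrix.mul_smul, hB, Matrix.diagonal_map (map_zero _)]
    ext i j
    simp [Matrix.diagonal_apply, Matrix.one_apply, Algebra.smul_def]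
  obtain ⟨p, hp⟩ : ∃ p : σ → k, eval p ((b : MvPolynomial σ k) * h) ≠ 0 := by
    by_contra! H
    exact mul_ne_zero (nonZeroDivisors.coe_ne_zero b) hh (MvPolynomial.funext fun x => by simp [H x])
  rw [map_mul] at hp
  refine ⟨p, right_ne_zero_of_mul hp, ?_⟩
  have hev := congrArg (fun M : Matrix u u (MvPolynomial σ k) => M.map (eval p)) hJB
  simp only [Matrix.map_mul, Matrix.diagonal_map (map_zero (eval p))] at hev
  have h1 : Fintype.card u ≤ (J.map (eval p)).rank := by
    refine le_trans ?_ (Matrix.rank_mul_le_left (J.map (eval p))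
      ((Matrix.of fun i j => B' (i, j)).map (eval p)))
    rw [hev]
    refine (Matrix.rank_of_det_ne_zero ?_).ge
    rw [Matrix.det_diagonal]
    exact Finset.prod_ne_zero_iff.2 fun _ _ => left_ne_zero_of_mul hp
  rw [← hucard]
  exact h1.trans (Matrix.rank_submatrix_le ((jacobianMatrix φ).map (eval p)) t id)

end MvPolynomial

end Jacobian

namespace SplitSecant

/-! ### Closures, cones and spans -/

section ProjectiveSets

variable {k : Type*} [Field k] {ι : Type*}

theorem eval_smul_of_isHomogeneous {F : MvPolynomial ι k} {m : ℕ} (hF : F.IsHomogeneous m)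
    (c : k) (v : ι → k) : eval (c • v) F = c ^ m * eval v F := by
  rw [eval_eq, eval_eq, Finset.mul_sum]
  refine Finset.sum_congr rfl fun e he => ?_
  have hdeg : ∑ i ∈ e.support, e i = m := by
    by_contra h
    exact mem_support_iff.1 he (hF.coeff_eq_zero h)
  simp only [Pi.smul_apply, smul_eq_mul, mul_pow, Finset.prod_mul_distrib,
    Finset.prod_pow_eq_pow_sum, hdeg]
  ring

theorem zero_mem_affineCone (X : Set (ℙ k (ι → k))) : (0 : ι → k) ∈ affineCone X :=
  fun h => (h rfl).elim

theorem smul_mem_affineCone {X : Set (ℙ k (ι → k))} {v : ι → k} (hv : v ∈ affineCone X) (c : k) :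
    c • v ∈ affineCone X := by
  intro h
  obtain ⟨hc, hv0⟩ := smul_ne_zero_iff.1 h
  have : Projectivization.mk k (c • v) h = Projectivization.mk k v hv0 :=
    (Projectivization.mk_eq_mk_iff' ..).2 ⟨c, rfl⟩
  rw [this]
  exact hv hv0

theorem rep_mem_affineCone {X : Set (ℙ k (ι → k))} {q : ℙ k (ι → k)} (hq : q ∈ X) :
    q.rep ∈ affineCone X := fun h => by rwa [Projectivization.mk_rep]

theorem subset_zariskiClosure (X : Set (ℙ k (ι → k))) : X ⊆ zariskiClosure X :=
  fun _ hp _ _ _ hF => hF _ hp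

theorem affineCone_mono {X Y : Set (ℙ k (ι → k))} (h : X ⊆ Y) : affineCone X ⊆ affineCone Y :=
  fun _ hv h0 => h (hv h0)

/-- The values of the components at `v` are the coefficients of the polynomial `c ↦ F(c • v)`, which
vanishes on an infinite field. -/
theorem eval_homogeneousComponent_eq_zero [Infinite k] {F : MvPolynomial ι k} {v : ι → k}
    (h : ∀ c : k, eval (c • v) F = 0) (m : ℕ) : eval v (homogeneousComponent m F) = 0 := by
  let P : Polynomial k := ∑ i ∈ Finset.range (F.totalDegree + 1),
    Polynomial.monomial i (eval v (homogeneousComponent i F))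
  have hP : P = 0 := by
    apply Polynomial.funext
    intro c
    have := h c
    rw [← sum_homogeneousComponent F, map_sum] at this
    simp only [P, Polynomial.eval_finsetSum, Polynomial.eval_monomial, Polynomial.eval_zero]
    rw [← this]
    exact Finset.sum_congr rfl fun i _ => by
      rw [eval_smul_of_isHomogeneous (homogeneousComponent_isHomogeneous i F), mul_comm]
  by_cases hm : m ∈ Finset.range (F.totalDegree + 1)
  · have := congrArg (fun Q => Polynomial.coeff Q m) hP
    simpa [P, Polynomial.finsetSum_coeff, Polynomial.coeff_monomial, Finset.sum_ite_eq', hm]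
      using this
  · rw [homogeneousComponent_eq_zero, map_zero]
    exact lt_of_not_ge fun h => hm (Finset.mem_range.2 (Nat.lt_succ_of_le h))

theorem vanishingIdeal_affineCone_zariskiClosure [Infinite k] (X : Set (ℙ k (ι → k))) :
    vanishingIdeal k (affineCone (zariskiClosure X)) = vanishingIdeal k (affineCone X) := by
  refine le_antisymm (vanishingIdeal_anti_mono (affineCone_mono (subset_zariskiClosure X))) ?_
  intro F hF
  rw [mem_vanishingIdeal_iff] at hF ⊢
  have hcomp : ∀ m, ∀ w ∈ affineCone X, eval w (homogeneousComponent m F) = 0 := fun m w hw =>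
    eval_homogeneousComponent_eq_zero (fun c => hF _ (smul_mem_affineCone hw c)) m
  intro v hv
  rw [← sum_homogeneousComponent F, map_sum]
  refine Finset.sum_eq_zero fun m _ => ?_
  by_cases h0 : v = 0
  · subst h0
    exact hcomp m 0 (zero_mem_affineCone X)
  · have h1 := hv h0 m _ (homogeneousComponent_isHomogeneous m F)
      fun q hq => hcomp m _ (rep_mem_affineCone hq)
    obtain ⟨a, ha⟩ := Projectivization.exists_smul_eq_mk_rep k v h0
    rw [← ha, Units.smul_def, eval_smul_of_isHomogeneous
      (homogeneousComponent_isHomogeneous m F)] at h1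
    exact (mul_eq_zero.1 h1).resolve_left (pow_ne_zero _ a.ne_zero)

theorem dim_zariskiClosure [Infinite k] (X : Set (ℙ k (ι → k))) :
    dim (zariskiClosure X) = dim X := by
  unfold dim CoordinateRing
  rw [vanishingIdeal_affineCone_zariskiClosure]

theorem spanUnion_one (X : Set (ℙ k (ι → k))) : spanUnion 1 X = X := by
  ext q
  constructor
  · rintro ⟨p, hp, hq⟩
    have h : q.submodule ≤ (p 0).submodule := by simpa using hq
    have h' := Submodule.eq_of_le_of_finrank_eq (K := k) h (by rw [q.finrank_submodule, (p 0).finrank_submodule])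
    rw [Projectivization.submodule_injective h']
    exact hp 0
  · exact fun hq => ⟨fun _ => q, fun _ => hq, by simp⟩

theorem dim_secantVariety_one [Infinite k] (X : Set (ℙ k (ι → k))) :
    dim (secantVariety 1 X) = dim X := by
  rw [secantVariety, dim_zariskiClosure, spanUnion_one]

theorem neg_one_le_dim (X : Set (ℙ k (ι → k))) : -1 ≤ dim X := by
  unfold dim; omega

theorem mem_affineCone_spanUnion {X : Set (ℙ k (ι → k))} (hX : X.Nonempty) {s : ℕ} {v : ι → k} :
    v ∈ affineCone (spanUnion s X) ↔
      ∃ w : Fin s → ι → k, (∀ i, w i ∈ affineCone X) ∧ v = ∑ i, w i := by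
  constructor
  · intro hv
    by_cases h0 : v = 0
    · exact ⟨0, fun _ => zero_mem_affineCone X, by simp [h0]⟩
    · obtain ⟨p, hp, hle⟩ := hv h0
      rw [Projectivization.submodule_mk, Submodule.span_singleton_le_iff_mem] at hle
      simp only [Projectivization.submodule_eq] at hle
      rw [← Submodule.span_range_eq_iSup, Submodule.mem_span_range_iff_exists_fun] at hle
      obtain ⟨c, hc⟩ := hle
      exact ⟨fun i => c i • (p i).rep,
        fun i => smul_mem_affineCone (rep_mem_affineCone (hp i)) _, hc.symm⟩
  · rintro ⟨w, hw, rfl⟩ h0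
    classical
    obtain ⟨q, hq⟩ := hX
    -- A zero summand defines no projective point; `q` fills its place.
    refine ⟨fun i => if h : w i ≠ 0 then Projectivization.mk k (w i) h else q, fun i => ?_, ?_⟩
    · dsimp only
      split_ifs with h
      · exact hw i h
      · exact hq
    · rw [Projectivization.submodule_mk, Submodule.span_singleton_le_iff_mem]
      refine Submodule.sum_mem _ fun i _ => ?_
      by_cases h : w i ≠ 0
      · refine Submodule.mem_iSup_of_mem i ?_
        beta_reduce
        rw [dif_pos h, Projectivization.submodule_mk]
        exact Submodule.mem_span_singleton_self _
      · rw [not_not.1 h]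
        exact Submodule.zero_mem _

end ProjectiveSets

/-! ### Parametrization of the secant cone and its differential -/

section Forms

variable {R S : Type*} [CommRing R] [CommRing S] {n d s : ℕ}

/-- The linear form with the given coefficients. -/
noncomputable def linearForm (c : Fin (n + 1) → R) : MvPolynomial (Fin (n + 1)) R :=
  ∑ i, C (c i) * X i

/-- A sum of `s` products of `d` linear forms with the given coefficients. -/
noncomputable def sumOfProducts (l : Fin s → Fin d → Fin (n + 1) → R) :
    MvPolynomial (Fin (n + 1)) R :=
  ∑ i, ∏ j, linearForm (l i j)

theorem isHomogeneous_linearForm (c : Fin (n + 1) → R) : (linearForm c).IsHomogeneous 1 :=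
  IsHomogeneous.sum _ _ _ fun i _ => isHomogeneous_C_mul_X (c i) i

theorem isHomogeneous_sumOfProducts (l : Fin s → Fin d → Fin (n + 1) → R) :
    (sumOfProducts l).IsHomogeneous d :=
  IsHomogeneous.sum _ _ _ fun i _ => by
    simpa using IsHomogeneous.prod Finset.univ _ _ fun j _ => isHomogeneous_linearForm (l i j)

theorem eval_linearForm (c x : Fin (n + 1) → R) : eval x (linearForm c) = c ⬝ᵥ x := by
  simp [linearForm, dotProduct]

theorem eval_sumOfProducts (l : Fin s → Fin d → Fin (n + 1) → R) (x : Fin (n + 1) → R) :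
    eval x (sumOfProducts l) = ∑ i, ∏ j, l i j ⬝ᵥ x := by
  simp [sumOfProducts, eval_linearForm]

theorem map_sumOfProducts (f : R →+* S) (l : Fin s → Fin d → Fin (n + 1) → R) :
    MvPolynomial.map f (sumOfProducts l) = sumOfProducts fun i j c => f (l i j c) := by
  simp [sumOfProducts, linearForm]

theorem exists_eq_linearForm {f : MvPolynomial (Fin (n + 1)) R} (hf : f.IsHomogeneous 1) :
    ∃ c, f = linearForm c := by
  rw [← mem_homogeneousSubmodule, homogeneousSubmodule_one_eq_span_X,
    Submodule.mem_span_range_iff_exists_fun] at hf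
  obtain ⟨c, rfl⟩ := hf
  exact ⟨c, by simp [linearForm, smul_eq_C_mul]⟩

theorem linearForm_smul (a : R) (c : Fin (n + 1) → R) : linearForm (a • c) = C a * linearForm c := by
  simp [linearForm, Finset.mul_sum, mul_assoc]

theorem mem_exponent_iff {m : Fin (n + 1) →₀ ℕ} :
    m ∈ Finset.finsuppAntidiag (Finset.univ : Finset (Fin (n + 1))) d ↔ m.degree = d := by
  simp [Finset.mem_finsuppAntidiag, Finsupp.degree_eq_sum]

theorem eval_eq_sum_exponent {f : MvPolynomial (Fin (n + 1)) R} (hf : f.IsHomogeneous d)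
    (x : Fin (n + 1) → R) :
    eval x f = ∑ m : Exponent n d, f.coeff m.1 * ∏ i, x i ^ m.1 i := by
  rw [eval_eq', Finset.sum_coe_sort (Finset.finsuppAntidiag Finset.univ d)
    (fun m => f.coeff m * ∏ i, x i ^ m i)]
  refine Finset.sum_subset (fun m hm => mem_exponent_iff.2 ?_) fun m _ hm => ?_
  · by_contra h
    exact mem_support_iff.1 hm (hf.coeff_eq_zero h)
  · rw [notMem_support_iff.1 hm, zero_mul]

variable {k : Type*} [Field k]

theorem split_nonempty : (split k d n).Nonempty := by
  have h : coeffVector n d ((X 0 : MvPolynomial (Fin (n + 1)) k) ^ d) ≠ 0 := by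
    intro h
    have := congrFun h ⟨Finsupp.single 0 d, mem_exponent_iff.2 (by simp)⟩
    simp [coeffVector, coeff_X_pow] at this
  exact ⟨_, _, h, ⟨fun _ => X 0, fun _ => isHomogeneous_X _ _, by simp⟩, rfl⟩

theorem mem_affineCone_split (hd : d ≠ 0) {v : Exponent n d → k} :
    v ∈ affineCone (split k d n) ↔
      ∃ l : Fin d → Fin (n + 1) → k, v = coeffVector n d (∏ j, linearForm (l j)) := by
  have : NeZero d := ⟨hd⟩
  constructor
  · intro hv
    by_cases h0 : v = 0
    · refine ⟨0, ?_⟩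
      rw [Finset.prod_eq_zero (Finset.mem_univ (0 : Fin d)) (by simp [linearForm]), h0]
      ext; simp [coeffVector]
    · obtain ⟨f, hf, ⟨l, hl, rfl⟩, h⟩ := hv h0
      obtain ⟨a, rfl⟩ := (Projectivization.mk_eq_mk_iff' ..).1 h
      choose c hc using fun i => exists_eq_linearForm (hl i)
      -- The scalar is absorbed into one factor, which needs `d ≠ 0`.
      refine ⟨Function.update c 0 (a • c 0), ?_⟩
      have h1 : ∏ j, linearForm (Function.update c 0 (a • c 0) j) = C a * ∏ j, l j := by
        rw [← Finset.mul_prod_erase _ _ (Finset.mem_univ (0 : Fin d)),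
          ← Finset.mul_prod_erase _ (fun j => l j) (Finset.mem_univ (0 : Fin d)), ← mul_assoc]
        congr 1
        · simp [linearForm_smul, hc]
        · refine Finset.prod_congr rfl fun j hj => ?_
          rw [Function.update_of_ne (Finset.ne_of_mem_erase hj), hc]
      rw [h1]
      ext m; simp [coeffVector]
  · rintro ⟨l, rfl⟩ h
    exact ⟨_, h, ⟨_, fun i => isHomogeneous_linearForm _, rfl⟩, rfl⟩

theorem mem_affineCone_spanUnion_split (hd : d ≠ 0) {v : Exponent n d → k} :
    v ∈ affineCone (spanUnion s (split k d n)) ↔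
      ∃ l : Fin s → Fin d → Fin (n + 1) → k, v = coeffVector n d (sumOfProducts l) := by
  have hsum : ∀ l : Fin s → Fin d → Fin (n + 1) → k, coeffVector n d (sumOfProducts l) =
      ∑ i, coeffVector n d (∏ j, linearForm (l i j)) := fun l => by
    ext m; simp [coeffVector, sumOfProducts, coeff_sum]
  rw [mem_affineCone_spanUnion split_nonempty]
  simp only [mem_affineCone_split hd, hsum]
  constructor
  · rintro ⟨w, hw, rfl⟩
    choose l hl using hw
    exact ⟨l, by simp [← hl]⟩
  · rintro ⟨l, rfl⟩
    exact ⟨_, fun i => ⟨l i, rfl⟩, rfl⟩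

/-- The index set for the coefficients of `s` tuples of `d` linear forms in `n + 1` variables. -/
abbrev Param (s d n : ℕ) : Type := Fin s × Fin d × Fin (n + 1)

variable (k) in
/-- The coefficients of a sum of `s` products of `d` linear forms with indeterminate
coefficients. -/
noncomputable def genericCoeff (s d n : ℕ) (m : Exponent n d) : MvPolynomial (Param s d n) k :=
  (sumOfProducts fun i j c => (X (i, j, c) : MvPolynomial (Param s d n) k)).coeff m.1

theorem eval_genericCoeff (p : Param s d n → k) :
    (fun m => eval p (genericCoeff k s d n m)) =
      coeffVector n d (sumOfProducts fun i j c => p (i, j, c)) := by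
  ext m
  rw [coeffVector, genericCoeff, ← coeff_map, map_sumOfProducts]
  simp

/-- The cone over the union of spans is exactly the image of the parametrization, and over an
infinite field a polynomial vanishing at all parameters is zero. -/
theorem vanishingIdeal_affineCone_secantVariety [Infinite k] (hd : d ≠ 0) :
    vanishingIdeal k (affineCone (secantVariety s (split k d n))) =
      RingHom.ker (aeval (R := k) (genericCoeff k s d n)) := by
  rw [secantVariety, vanishingIdeal_affineCone_zariskiClosure]
  ext F
  have h : ∀ p : Param s d n → k, eval p (aeval (genericCoeff k s d n) F) =
      aeval (coeffVector n d (sumOfProducts fun i j c => p (i, j, c))) F := fun p => by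
    rw [← eval_genericCoeff, ← coe_aeval_eq_eval]
    exact comp_aeval_apply _ (aeval p) F
  rw [mem_vanishingIdeal_iff, RingHom.mem_ker]
  constructor
  · intro hF
    refine MvPolynomial.funext fun p => ?_
    rw [h, map_zero]
    exact hF _ ((mem_affineCone_spanUnion_split hd).2 ⟨_, rfl⟩)
  · intro hF v hv
    obtain ⟨l, rfl⟩ := (mem_affineCone_spanUnion_split hd).1 hv
    have := h fun q => l q.1 q.2.1 q.2.2
    rw [hF, map_zero] at this
    exact this.symm

theorem exists_dim_secantVariety_split [Infinite k] (hd : d ≠ 0) :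
    ∃ e : ℕ, dim (secantVariety s (split k d n)) = e - 1 ∧
      Algebra.trdeg k (aeval (R := k) (genericCoeff k s d n)).range = e := by
  let f := aeval (R := k) (genericCoeff k s d n)
  have : Algebra.FiniteType k f.range :=
    Algebra.FiniteType.of_surjective f.rangeRestrict f.rangeRestrict_surjective
  obtain ⟨e, he, htr⟩ := exists_ringKrullDim_eq_trdeg k f.range
  refine ⟨e, ?_, htr⟩
  have h1 : ringKrullDim (CoordinateRing (secantVariety s (split k d n))) = e := by
    rw [← he]
    change ringKrullDim (_ ⧸ vanishingIdeal k (affineCone (secantVariety s (split k d n)))) = _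
    rw [vanishingIdeal_affineCone_secantVariety hd]
    exact ringKrullDim_eq_of_ringEquiv (Ideal.quotientKerEquivRange f).toRingEquiv
  rw [dim, h1]
  rfl

theorem _root_.Derivation.leibniz_finset_prod {k A ι : Type*} [CommRing k] [CommRing A]
    [Algebra k A] [DecidableEq ι] (D : Derivation k A A) (t : Finset ι) (f : ι → A) :
    D (∏ j ∈ t, f j) = ∑ j ∈ t, D (f j) * ∏ i ∈ t.erase j, f i := by
  induction t using Finset.induction_on with
  | empty => simp
  | insert a t ha ih =>
    rw [Finset.prod_insert ha, D.leibniz, ih, Finset.sum_insert ha, Finset.erase_insert ha,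
      smul_eq_mul, smul_eq_mul, add_comm, mul_comm, Finset.mul_sum]
    congr 1
    refine Finset.sum_congr rfl fun j hj => ?_
    have hja : a ≠ j := fun h => ha (h ▸ hj)
    rw [Finset.erase_insert_of_ne hja, Finset.prod_insert (fun h => ha (Finset.mem_of_mem_erase h))]
    ring

/-- The differential at `p` of the map sending coefficients of linear forms to the sum of products
of these forms, with forms considered as functions. -/
def tangentMap (p : Fin s → Fin d → Fin (n + 1) → k) :
    (Fin s → Fin d → Fin (n + 1) → k) →ₗ[k] ((Fin (n + 1) → k) → k) where
  toFun v x := ∑ i, ∑ j, (v i j ⬝ᵥ x) * ∏ j' ∈ Finset.univ.erase j, p i j' ⬝ᵥ x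
  map_add' v w := by
    funext x
    simp [add_dotProduct, add_mul, Finset.sum_add_distrib]
  map_smul' c v := by
    funext x
    simp [smul_dotProduct, Finset.mul_sum, mul_assoc]

theorem tangentMap_apply (p v : Fin s → Fin d → Fin (n + 1) → k) (x : Fin (n + 1) → k) :
    tangentMap p v x =
      ∑ i, ∑ j, (v i j ⬝ᵥ x) * ∏ j' ∈ Finset.univ.erase j, p i j' ⬝ᵥ x := rfl

theorem jacobianMatrix_mulVec_eq_zero_iff [Infinite k] (p v : Param s d n → k) :
    ((jacobianMatrix (genericCoeff k s d n)).map (eval p)).mulVec v = 0 ↔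
      tangentMap (fun i j c => p (i, j, c)) (fun i j c => v (i, j, c)) = 0 := by
  let D : Derivation k (MvPolynomial (Param s d n) k) (MvPolynomial (Param s d n) k) :=
    ∑ q, v q • pderiv q
  have hD : ∀ G, D G = ∑ q, v q • pderiv q G := fun G => by
    rw [← Derivation.coeFnAddMonoidHom_apply, map_sum, Finset.sum_apply]
    rfl
  have hDX : ∀ q, D (X q) = C (v q) := fun q => by
    rw [hD, Finset.sum_eq_single q]
    · simp [smul_eq_C_mul]
    · intro b _ hb; simp [hb.symm]
    · simp
  have hJ : ∀ m, ((jacobianMatrix (genericCoeff k s d n)).map (eval p)).mulVec v m =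
      eval p (D (genericCoeff k s d n m)) := fun m => by
    rw [hD, map_sum]
    simp [Matrix.mulVec, dotProduct, jacobianMatrix, smul_eval, mul_comm]
  -- The form whose coefficients are the Jacobian applied to `v`; as a function it is the value of
  -- `tangentMap`.
  let g : MvPolynomial (Fin (n + 1)) k :=
    ∑ m : Exponent n d, monomial m.1 (eval p (D (genericCoeff k s d n m)))
  have hg : ∀ x, eval x g =
      tangentMap (fun i j c => p (i, j, c)) (fun i j c => v (i, j, c)) x := fun x => by
    have h1 := eval_eq_sum_exponent (isHomogeneous_sumOfProducts
      fun i j c => (X (i, j, c) : MvPolynomial (Param s d n) k)) (fun c => C (x c))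
    rw [eval_sumOfProducts] at h1
    have h2 := congrArg (fun G => eval p (D G)) h1
    simp only [map_sum, ← map_pow, ← map_prod] at h2
    have h3 : ∀ m : Exponent n d, D (genericCoeff k s d n m * ∏ i, C (x i ^ m.1 i)) =
        D (genericCoeff k s d n m) * C (∏ i, x i ^ m.1 i) := fun m => by
      rw [← map_prod, mul_comm, ← smul_eq_C_mul, D.map_smul, smul_eq_C_mul, mul_comm]
    have h4 : ∀ i j, D ((fun c => X (i, j, c)) ⬝ᵥ fun c => C (x c)) =
        C ((fun c => v (i, j, c)) ⬝ᵥ x) := fun i j => by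
      simp only [dotProduct, map_sum]
      refine Finset.sum_congr rfl fun c _ => ?_
      rw [mul_comm, ← smul_eq_C_mul, D.map_smul, smul_eq_C_mul, hDX, mul_comm, map_mul]
    have h5 : ∀ i j, eval p ((fun c => X (i, j, c)) ⬝ᵥ fun c => C (x c)) =
        (fun c => p (i, j, c)) ⬝ᵥ x := fun i j => by
      simp [dotProduct]
    simp only [D.leibniz_finset_prod, h4, map_sum, map_mul, eval_C, map_prod, h5] at h2
    rw [tangentMap_apply, h2, map_sum]
    refine Finset.sum_congr rfl fun m _ => ?_
    rw [eval_monomial, Finsupp.prod_fintype _ _ (by simp)]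
    have := congrArg (eval p) (h3 m)
    rw [RingHom.map_mul (eval p), eval_C] at this
    exact this.symm
  have hcoeff : ∀ m : Exponent n d, g.coeff m.1 = eval p (D (genericCoeff k s d n m)) := fun m => by
    simp only [g, coeff_sum, coeff_monomial]
    rw [Finset.sum_eq_single m]
    · simp
    · intro b _ hb
      rw [if_neg fun h => hb (Subtype.ext h)]
    · simp
  constructor
  · intro h
    have : g = 0 := Finset.sum_eq_zero fun m _ => by rw [← hJ, h, Pi.zero_apply, map_zero]
    refine _root_.funext fun x => ?_
    rw [← hg, this, map_zero, Pi.zero_apply]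
  · intro h
    have : g = 0 := MvPolynomial.funext fun x => by rw [hg, h, map_zero, Pi.zero_apply]
    refine _root_.funext fun m => ?_
    rw [hJ, ← hcoeff, this, coeff_zero, Pi.zero_apply]

theorem rank_jacobianMatrix_add_finrank_ker [Infinite k] (p : Param s d n → k) :
    ((jacobianMatrix (genericCoeff k s d n)).map (eval p)).rank +
      Module.finrank k (LinearMap.ker (tangentMap fun i j c => p (i, j, c))) =
        s * (d * (n + 1)) := by
  let e : (Param s d n → k) ≃ₗ[k] (Fin s → Fin d → Fin (n + 1) → k) :=
    { toFun := fun v i j c => v (i, j, c)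
      invFun := fun v q => v q.1 q.2.1 q.2.2
      map_add' := fun _ _ => rfl
      map_smul' := fun _ _ => rfl
      left_inv := fun _ => rfl
      right_inv := fun _ => rfl }
  set M := (jacobianMatrix (genericCoeff k s d n)).map (eval p)
  have hker : (LinearMap.ker M.mulVecLin).map (e : (Param s d n → k) →ₗ[k] _) =
      LinearMap.ker (tangentMap fun i j c => p (i, j, c)) := by
    ext v
    rw [Submodule.mem_map_equiv, LinearMap.mem_ker, LinearMap.mem_ker]
    exact jacobianMatrix_mulVec_eq_zero_iff p (e.symm v)
  rw [← hker, LinearEquiv.finrank_map_eq, Matrix.rank, LinearMap.finrank_range_add_finrank_ker]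
  simp

/-- Every parameter point bounds the dimension from below, and a general one attains it. -/
theorem dim_secantVariety_split_bounds [CharZero k] (hd : d ≠ 0) :
    (∀ p : Fin s → Fin d → Fin (n + 1) → k, (s * (d * (n + 1)) : ℤ) ≤
      dim (secantVariety s (split k d n)) + 1 + Module.finrank k (LinearMap.ker (tangentMap p))) ∧
    ∃ p : Fin s → Fin d → Fin (n + 1) → k, (∀ i j, p i j ≠ 0) ∧
      dim (secantVariety s (split k d n)) + 1 + Module.finrank k (LinearMap.ker (tangentMap p)) ≤
        (s * (d * (n + 1)) : ℤ) := by
  obtain ⟨e, hdim, he⟩ := exists_dim_secantVariety_split (k := k) (s := s) (n := n) hd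
  rw [hdim]
  constructor
  · intro p
    have h1 := rank_jacobianMatrix_le_trdeg _ (fun q => p q.1 q.2.1 q.2.2) he
    have h2 : _ + Module.finrank k (LinearMap.ker (tangentMap p)) = _ :=
      rank_jacobianMatrix_add_finrank_ker fun q : Param s d n => p q.1 q.2.1 q.2.2
    push_cast [← @Nat.cast_inj ℤ] at h2
    omega
  · obtain ⟨p, hp, hr⟩ := exists_trdeg_le_rank_jacobianMatrix _ he
      -- Nonvanishing of this product makes every linear form nonzero.
      (∏ i, ∏ j, X (i, j, 0)) (Finset.prod_ne_zero_iff.2 fun i _ =>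
        Finset.prod_ne_zero_iff.2 fun j _ => X_ne_zero _)
    refine ⟨fun i j c => p (i, j, c), fun i j h => hp ?_, ?_⟩
    · rw [map_prod, Finset.prod_eq_zero (Finset.mem_univ i)]
      rw [map_prod, Finset.prod_eq_zero (Finset.mem_univ j)]
      simpa using congrFun h 0
    · have h2 := rank_jacobianMatrix_add_finrank_ker p
      push_cast [← @Nat.cast_inj ℤ] at h2
      omega

end Forms

/-! ### Kernels of the tangent map -/

section TangentSpaces

variable {k : Type*} [Field k] {n s d : ℕ}

variable (k s d) in
/-- The row sums of an `s × d` matrix. -/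
def rowSum : (Fin s → Fin d → k) →ₗ[k] (Fin s → k) where
  toFun b i := ∑ j, b i j
  map_add' _ _ := by funext; simp [Finset.sum_add_distrib]
  map_smul' _ _ := by funext; simp [Finset.mul_sum]

/-- Scaling each linear form by its own factor. -/
def scaleForms (p : Fin s → Fin d → Fin (n + 1) → k) :
    (Fin s → Fin d → k) →ₗ[k] (Fin s → Fin d → Fin (n + 1) → k) where
  toFun b i j := b i j • p i j
  map_add' _ _ := by funext; simp [add_mul]
  map_smul' _ _ := by funext; simp [mul_assoc]

theorem scaleForms_injective {p : Fin s → Fin d → Fin (n + 1) → k} (hp : ∀ i j, p i j ≠ 0) :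
    Function.Injective (scaleForms p) := by
  rw [← LinearMap.ker_eq_bot, LinearMap.ker_eq_bot']
  intro b hb
  funext i j
  exact (smul_eq_zero.1 (congrFun (congrFun hb i) j)).resolve_right (hp i j)

theorem finrank_ker_rowSum (hd : d ≠ 0) :
    Module.finrank k (LinearMap.ker (rowSum k s d)) + s = s * d := by
  have : NeZero d := ⟨hd⟩
  have hsurj : Function.Surjective (rowSum k s d) := fun c =>
    ⟨fun i => Pi.single 0 (c i), by funext i; simp [rowSum]⟩
  have h := LinearMap.finrank_range_add_finrank_ker (rowSum k s d)
  rw [LinearMap.range_eq_top.2 hsurj, finrank_top] at h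
  simp [Module.finrank_pi_fintype] at h
  omega

theorem tangentMap_scaleForms (p : Fin s → Fin d → Fin (n + 1) → k) (b : Fin s → Fin d → k)
    (x : Fin (n + 1) → k) :
    tangentMap p (scaleForms p b) x = ∑ i, rowSum k s d b i * ∏ j, p i j ⬝ᵥ x := by
  rw [tangentMap_apply]
  refine Finset.sum_congr rfl fun i _ => ?_
  change _ = (∑ j, b i j) * _
  rw [Finset.sum_mul]
  refine Finset.sum_congr rfl fun j _ => ?_
  change (b i j • p i j) ⬝ᵥ x * _ = _
  rw [smul_dotProduct, smul_eq_mul, mul_assoc,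
    Finset.mul_prod_erase _ (fun j => p i j ⬝ᵥ x) (Finset.mem_univ j)]

/-- Rescaling the factors multiplies each product, to first order, by the sum of its scalars. -/
theorem map_scaleForms_le_ker (p : Fin s → Fin d → Fin (n + 1) → k) :
    (LinearMap.ker (rowSum k s d)).map (scaleForms p) ≤ LinearMap.ker (tangentMap p) := by
  rintro _ ⟨b, hb, rfl⟩
  rw [LinearMap.mem_ker]
  funext x
  rw [tangentMap_scaleForms, LinearMap.mem_ker.1 hb]
  simp

theorem finrank_map_scaleForms (hd : d ≠ 0) {p : Fin s → Fin d → Fin (n + 1) → k}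
    (hp : ∀ i j, p i j ≠ 0) :
    Module.finrank k ((LinearMap.ker (rowSum k s d)).map (scaleForms p)) + s = s * d := by
  rw [← (Submodule.equivMapOfInjective _ (scaleForms_injective hp) _).finrank_eq,
    finrank_ker_rowSum hd]

theorem le_finrank_ker_tangentMap (hd : d ≠ 0) {p : Fin s → Fin d → Fin (n + 1) → k}
    (hp : ∀ i j, p i j ≠ 0) :
    s * d ≤ Module.finrank k (LinearMap.ker (tangentMap p)) + s := by
  rw [← finrank_map_scaleForms hd hp]
  exact Nat.add_le_add_right (Submodule.finrank_mono (map_scaleForms_le_ker p)) s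

theorem ker_tangentMap_eq (hd : d ≠ 0) {p : Fin s → Fin d → Fin (n + 1) → k}
    (hp : ∀ i j, p i j ≠ 0) (h : Module.finrank k (LinearMap.ker (tangentMap p)) + s ≤ s * d) :
    LinearMap.ker (tangentMap p) = (LinearMap.ker (rowSum k s d)).map (scaleForms p) := by
  refine (Submodule.eq_of_le_of_finrank_le (map_scaleForms_le_ker p) ?_).symm
  have := finrank_map_scaleForms hd hp
  omega

/-- If the tangent spaces at the products `∏ j, p i j` have the expected dimension and are
independent, then the products with one factor omitted are linearly independent. -/
theorem eq_zero_of_sum_mul_prod_erase_eq_zero (hd : d ≠ 0) (hn : n ≠ 0)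
    {p : Fin s → Fin d → Fin (n + 1) → k} (hp : ∀ i j, p i j ≠ 0)
    (h : Module.finrank k (LinearMap.ker (tangentMap p)) + s ≤ s * d) (c : Fin s → Fin d → k)
    (hc : ∀ x : Fin (n + 1) → k,
      ∑ i, ∑ j, c i j * ∏ j' ∈ Finset.univ.erase j, p i j' ⬝ᵥ x = 0) : c = 0 := by
  funext i j
  by_contra hij
  have hspan : ∀ w : Fin (n + 1) → k, ∃ a : k, a • p i j = w := fun w => by
    -- The relation multiplied by the linear form `w`.
    have hmem : (fun i j => c i j • w) ∈ LinearMap.ker (tangentMap p) := by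
      rw [LinearMap.mem_ker]
      funext x
      rw [tangentMap_apply, Pi.zero_apply, ← mul_zero (w ⬝ᵥ x), ← hc x, Finset.mul_sum]
      refine Finset.sum_congr rfl fun i _ => ?_
      rw [Finset.mul_sum]
      refine Finset.sum_congr rfl fun j _ => ?_
      rw [smul_dotProduct, smul_eq_mul]
      ring
    rw [ker_tangentMap_eq hd hp h] at hmem
    obtain ⟨b, -, hb⟩ := hmem
    have hb' : b i j • p i j = c i j • w := congrFun (congrFun hb i) j
    refine ⟨(c i j)⁻¹ * b i j, ?_⟩
    rw [mul_smul, hb', inv_smul_smul₀ hij]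
  have := finrank_le_one _ hspan
  rw [Module.finrank_fintype_fun_eq_card, Fintype.card_fin] at this
  omega

theorem dotProduct_snoc (v : Fin (n + 2) → k) (x : Fin (n + 1) → k) (c : k) :
    v ⬝ᵥ (Fin.snoc x c : Fin (n + 2) → k) = (fun i => v i.castSucc) ⬝ᵥ x + v (Fin.last _) * c := by
  simp [dotProduct, Fin.sum_univ_castSucc]

/-- Forgetting the last coordinate maps the new kernel injectively to the old one: `p` does not
involve the new variable, so its coefficient is a relation among products with one factor omitted.
-/
theorem finrank_ker_tangentMap_snoc_le (hd : d ≠ 0) (hn : n ≠ 0)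
    {p : Fin s → Fin d → Fin (n + 1) → k} (hp : ∀ i j, p i j ≠ 0)
    (h : Module.finrank k (LinearMap.ker (tangentMap p)) + s ≤ s * d) :
    Module.finrank k (LinearMap.ker
      (tangentMap (n := n + 1) fun i j => (Fin.snoc (p i j) 0 : Fin (n + 2) → k))) ≤
      Module.finrank k (LinearMap.ker (tangentMap p)) := by
  let p' : Fin s → Fin d → Fin (n + 1 + 1) → k := fun i j => Fin.snoc (p i j) 0
  let r : (Fin s → Fin d → Fin (n + 1 + 1) → k) →ₗ[k] (Fin s → Fin d → Fin (n + 1) → k) :=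
    { toFun := fun v i j c => v i j c.castSucc
      map_add' := fun _ _ => rfl
      map_smul' := fun _ _ => rfl }
  have hp' : ∀ i j (x : Fin (n + 1) → k) (c : k),
      p' i j ⬝ᵥ (Fin.snoc x c : Fin (n + 2) → k) = p i j ⬝ᵥ x := fun i j x c => by
    rw [dotProduct_snoc]
    simp [p']
  have heval : ∀ v (x : Fin (n + 1) → k) (c : k),
      tangentMap p' v (Fin.snoc x c : Fin (n + 2) → k) = tangentMap p (r v) x +
        c * ∑ i, ∑ j, v i j (Fin.last _) * ∏ j' ∈ Finset.univ.erase j, p i j' ⬝ᵥ x := by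
    intro v x c
    simp only [tangentMap_apply, hp', dotProduct_snoc, Finset.mul_sum, ← Finset.sum_add_distrib]
    refine Finset.sum_congr rfl fun i _ => Finset.sum_congr rfl fun j _ => ?_
    change (_ + _) * _ = (fun c : Fin (n + 1) => v i j c.castSucc) ⬝ᵥ x * _ + _
    ring
  have hmaps : ∀ v ∈ LinearMap.ker (tangentMap p'), r v ∈ LinearMap.ker (tangentMap p) := by
    intro v hv
    rw [LinearMap.mem_ker] at hv ⊢
    funext x
    have := heval v x 0
    rw [hv, zero_mul, add_zero] at this
    exact this.symm
  refine LinearMap.finrank_le_finrank_of_injective (f := r.restrict hmaps) ?_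
  rw [← LinearMap.ker_eq_bot, LinearMap.ker_eq_bot']
  rintro ⟨v, hv⟩ hrv
  have hrv' : r v = 0 := congrArg Subtype.val hrv
  have hlast : (fun i j => v i j (Fin.last _)) = 0 := by
    refine eq_zero_of_sum_mul_prod_erase_eq_zero hd hn hp h _ fun x => ?_
    have := heval v x 1
    rw [LinearMap.mem_ker.1 hv, hrv', map_zero, one_mul] at this
    simpa using this.symm
  refine Subtype.ext ?_
  funext i j c
  refine Fin.lastCases ?_ (fun c => ?_) c
  · exact congrFun (congrFun hlast i) j
  · exact congrFun (congrFun (congrFun hrv' i) j) c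

theorem exists_finrank_ker_tangentMap_le_of_le (hd : d ≠ 0) (hn : n ≠ 0)
    (h : ∃ p : Fin s → Fin d → Fin (n + 1) → k, (∀ i j, p i j ≠ 0) ∧
      Module.finrank k (LinearMap.ker (tangentMap p)) + s ≤ s * d) {m : ℕ} (hm : n ≤ m) :
    ∃ p : Fin s → Fin d → Fin (m + 1) → k, (∀ i j, p i j ≠ 0) ∧
      Module.finrank k (LinearMap.ker (tangentMap p)) + s ≤ s * d := by
  induction m, hm using Nat.le_induction with
  | base => exact h
  | succ m hm ih =>
    obtain ⟨p, hp, hrank⟩ := ih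
    refine ⟨fun i j => (Fin.snoc (p i j) 0 : Fin (m + 2) → k), fun i j h0 => hp i j ?_, ?_⟩
    · funext c
      simpa using congrFun h0 c.castSucc
    · exact (Nat.add_le_add_right
        (finrank_ker_tangentMap_snoc_le hd (by omega) hp hrank) s).trans hrank

/-- Take the factors `x₀ - t_j x₁` with distinct `t_j`. Where the `j`-th vanishes and `x₁ = 1`, only
the `j`-th term survives, so `v 0 j` vanishes there and is proportional to that factor. -/
theorem exists_finrank_ker_tangentMap_one_le [CharZero k] (hd : d ≠ 0) (hn : n ≠ 0) :
    ∃ p : Fin 1 → Fin d → Fin (n + 1) → k,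
      Module.finrank k (LinearMap.ker (tangentMap p)) + 1 ≤ d := by
  obtain ⟨n, rfl⟩ : ∃ m, n = m + 1 := ⟨n - 1, by omega⟩
  let t : Fin d → k := fun j => (j : ℕ)
  have ht : ∀ i j, i ≠ j → t i - t j ≠ 0 := fun i j hij h0 =>
    hij (Fin.ext (Nat.cast_injective (sub_eq_zero.1 h0)))
  let p : Fin 1 → Fin d → Fin (n + 1 + 1) → k :=
    fun _ j => Pi.single 0 1 - t j • Pi.single 1 1
  have hpx : ∀ i j x, p i j ⬝ᵥ x = x 0 - t j * x 1 := fun i j x => by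
    simp [p, sub_dotProduct]
  have hle : LinearMap.ker (tangentMap p) ≤
      (LinearMap.ker (rowSum k 1 d)).map (scaleForms p) := by
    intro v hv
    rw [LinearMap.mem_ker] at hv
    have hzero : ∀ j x, x 0 = t j → x 1 = 1 → v 0 j ⬝ᵥ x = 0 := by
      intro j x h0 h1
      have hx := congrFun hv x
      rw [tangentMap_apply, Fin.sum_univ_one, Finset.sum_eq_single j] at hx
      · refine (mul_eq_zero.1 hx).resolve_right (Finset.prod_ne_zero_iff.2 fun j' hj' => ?_)
        rw [hpx 0, h0, h1, mul_one]
        exact ht _ _ (Finset.ne_of_mem_erase hj').symm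
      · intro b _ hb
        rw [Finset.prod_eq_zero (Finset.mem_erase.2 ⟨hb.symm, Finset.mem_univ j⟩), mul_zero]
        rw [hpx 0, h0, h1, mul_one, sub_self]
      · simp
    have hbase : ∀ j, v 0 j 0 * t j + v 0 j 1 = 0 := fun j => by
      have := hzero j (t j • Pi.single 0 1 + Pi.single 1 1) (by simp) (by simp)
      simpa [dotProduct_add, mul_comm] using this
    have hrest : ∀ j c, c ≠ 0 → c ≠ 1 → v 0 j c = 0 := fun j c h0 h1 => by
      have := hzero j (t j • Pi.single 0 1 + Pi.single 1 1 + Pi.single c 1)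
        (by simp [h0.symm]) (by simp [h1.symm])
      have hb := hbase j
      simp only [dotProduct_add, dotProduct_smul, dotProduct_single, mul_one, smul_eq_mul] at this
      linear_combination this - hb
    have hv' : scaleForms p (fun i j => v i j 0) = v := by
      funext i j c
      obtain rfl : i = 0 := Subsingleton.elim _ _
      change v 0 j 0 * p 0 j c = v 0 j c
      by_cases h0 : c = 0
      · subst h0; simp [p]
      · by_cases h1 : c = 1
        · subst h1
          have hb := hbase j
          simp [p]
          linear_combination -hb
        · simp [p, h0, h1, hrest j c h0 h1]
    refine ⟨_, ?_, hv'⟩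
    rw [SetLike.mem_coe, LinearMap.mem_ker]
    -- All factors equal 1 at this point, so the row sum vanishes.
    have hx := congrFun hv (Pi.single 0 1)
    rw [← hv', tangentMap_scaleForms] at hx
    funext i
    obtain rfl : i = 0 := Subsingleton.elim _ _
    simpa [hpx] using hx
  refine ⟨p, ?_⟩
  have h1 := Submodule.finrank_mono hle
  have h2 := Submodule.finrank_map_le (scaleForms p) (LinearMap.ker (rowSum k 1 d))
  have h3 := finrank_ker_rowSum (k := k) (s := 1) hd
  omega

end TangentSpaces

/-! ### Dimension of the split variety and conclusion -/

theorem card_exponent (n d : ℕ) : Fintype.card (Exponent n d) = (n + d).choose d := by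
  rw [Fintype.card_coe, Finset.card_finsuppAntidiag_nat_eq_choose, Finset.card_univ,
    Fintype.card_fin]
  congr 1
  omega

theorem le_dim_split {k : Type*} [Field k] [CharZero k] {d n : ℕ} (hd : d ≠ 0) (hn : n ≠ 0) :
    (d * n : ℤ) ≤ dim (split k d n) := by
  obtain ⟨p, hp⟩ := exists_finrank_ker_tangentMap_one_le (k := k) hd hn
  have h := (dim_secantVariety_split_bounds (k := k) (s := 1) (n := n) hd).1 p
  rw [dim_secantVariety_one] at h
  zify at hp
  push_cast at h
  linarith

theorem dim_split_le {k : Type*} [Field k] [CharZero k] {d n : ℕ} (hd : d ≠ 0) :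
    dim (split k d n) ≤ (d * n : ℤ) := by
  obtain ⟨p, hp, h⟩ := (dim_secantVariety_split_bounds (k := k) (s := 1) (n := n) hd).2
  have h' := le_finrank_ker_tangentMap hd hp
  rw [dim_secantVariety_one] at h
  zify at h'
  push_cast at h
  linarith

end SplitSecant

theorem theorem4p3p2 {k : Type*} [Field k] [IsAlgClosed k] [CharZero k] (d s n₀ : ℕ)
    (hs : s * (d * n₀ + 1) ≤ (n₀ + d).choose d)
    (h₀ : SplitSecant.SecantNondefective s (SplitSecant.split k d n₀)) :
    ∀ n : ℕ, n₀ ≤ n → SplitSecant.SecantNondefective s (SplitSecant.split k d n) := by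
  intro n hn
  open SplitSecant in
  rw [SecantNondefective, SecantDefective, not_lt, expDim] at h₀ ⊢
  -- For `s ≤ 1` nondefectivity is automatic; for `s ≥ 2` the numerical hypothesis excludes `d = 0`
  -- and `n₀ = 0`, where the binomial is 1.
  rcases Nat.lt_or_ge s 2 with h2 | h2
  · refine (min_le_left _ _).trans ?_
    interval_cases s
    · simpa using neg_one_le_dim _
    · rw [dim_secantVariety_one]
      simp
  have hd : d ≠ 0 := by
    rintro rfl
    simp at hs
    omega
  have hn₀ : n₀ ≠ 0 := by
    rintro rfl
    simp at hs
    omega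
  -- Both terms of the minimum are at least `s * (d * n₀ + 1) - 1`, the second by `hs`.
  have hσ : (s * (d * n₀ + 1) : ℤ) ≤ dim (secantVariety s (split k d n₀)) + 1 := by
    have h3 : (s * (d * n₀ + 1) : ℤ) ≤ s * (dim (split k d n₀) + 1) :=
      mul_le_mul_of_nonneg_left (by linarith [le_dim_split (k := k) hd hn₀]) (by positivity)
    rw [card_exponent] at h₀
    zify at hs
    rcases min_le_iff.1 h₀ with h | h <;> linarith
  obtain ⟨p, hp, hker⟩ := (dim_secantVariety_split_bounds (k := k) (s := s) (n := n₀) hd).2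
  obtain ⟨p', hp', hker'⟩ := exists_finrank_ker_tangentMap_le_of_le hd hn₀
    ⟨p, hp, by zify; linarith⟩ hn
  have hbound := (dim_secantVariety_split_bounds (k := k) (s := s) (n := n) hd).1 p'
  refine (min_le_left _ _).trans ?_
  have h4 : (s * (dim (split k d n) + 1) : ℤ) ≤ s * (d * n + 1) :=
    mul_le_mul_of_nonneg_left (by linarith [dim_split_le (k := k) (n := n) hd]) (by positivity)
  zify at hker'
  linarith
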